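/- Let $M$ be a smooth ($C^\infty$, Hausdorff, finite-dimensional, without boundary) manifold, and let $P\in\Gamma(\wedge^3TM)$ be a smooth $3$-vector field whose bracket $\{f_1,f_2,f_3\}=P(df_1,df_2,df_3)$ on $C^\infty(M)$ is a ternary Poisson bracket, i.e. satisfies the generalized Jacobi identity $$\sum_{\sigma\in S_5}(\operatorname{sign}\sigma)\,\{\{f_{\sigma_1},f_{\sigma_2},f_{\sigma_3}\},f_{\sigma_4},f_{\sigma_5}\}=0\qquad(f_1,\dots,f_5\in C^\infty(M)).$$ For $x\in M$ let $\sharp_{P}:\wedge^2T_x^*M\to T_xM$, $\sharp_P(\lambda)=i(\lambda)P$, so that $\sharp_P(\alpha\wedge\beta)=P(\alpha,\beta,\cdot)$. Then $\{\cdot,\cdot,\cdot\}$ is a Nambu–Poisson bracket, i.e. a skew-symmetric trilinear operation on $C^\infty(M)$ that is a derivation in each entry and satisfies the fundamental identity $$\{f_1,f_2,\{g_1,g_2,g_3\}\}=\{\{f_1,f_2,g_1\},g_2,g_3\}+\{g_1,\{f_1,f_2,g_2\},g_3\}+\{g_1,g_2,\{f_1,f_2,g_3\}\},$$ if and only if the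 (possibly singular) distribution $x\mapsto \operatorname{im}\sharp_{P_x}\subseteq T_xM$ is involutive, i.e. whenever $X,Y$ are smooth vector fields on an open set $U\subseteq M$ with $X_x,Y_x\in\operatorname{im}\sharp_{P_x}$ for all $x\in U$, also $[X,Y]_x\in\operatorname{im}\sharp_{P_x}$ for all $x\in U$. -/

import Mathlib

open scoped Manifold ContDiff

noncomputable section

namespace NambuPoisson

section Algebra

variable {L : Type*} [AddCommGroup L] [Module ℝ L] [FiniteDimensional ℝ L]

/-- A trivector on a finite-dimensional real vector space `L`, i.e. a completely skew-symmetric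
contravariant 3-tensor: an alternating trilinear form on the dual of `L`. -/
abbrev Trivector (L : Type*) [AddCommGroup L] [Module ℝ L] : Type _ :=
  (Module.Dual ℝ L) [⋀^Fin 3]→ₗ[ℝ] ℝ

/-- The map `♯_P : ⋀² L* → L`, `♯_P(λ) = i(λ) P`. It is obtained from
`γ ↦ ((α ∧ β) ↦ P (γ, α, β) = P (α, β, γ))` through the identification of `L` with its bidual;
see `apply_sharp`. -/
def sharp (P : Trivector L) : ⋀[ℝ]^2 (Module.Dual ℝ L) →ₗ[ℝ] L :=
  (Module.evalEquiv ℝ L).symm.toLinearMap ∘ₗ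
    (exteriorPower.alternatingMapLinearEquiv.toLinearMap ∘ₗ
      AlternatingMap.curryLeft P).flip

/-- `♯_P (α ∧ β)` is the vector `P (α, β, ·)`. -/
theorem apply_sharp (P : Trivector L) (α β γ : Module.Dual ℝ L) :
    γ (sharp P (exteriorPower.ιMulti ℝ 2 ![α, β])) = P ![α, β, γ] := by
  have h : γ (sharp P (exteriorPower.ιMulti ℝ 2 ![α, β])) = P ![γ, α, β] := by
    simp [sharp, exteriorPower.alternatingMapLinearEquiv_apply_ιMulti]
  rw [h]
  have h1 := P.map_swap ![γ, α, β] (i := 0) (j := 1) (by decide)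
  have h2 := P.map_swap ![α, γ, β] (i := 1) (j := 2) (by decide)
  have e1 : (![γ, α, β] ∘ Equiv.swap (0 : Fin 3) 1) = ![α, γ, β] := by
    funext i; fin_cases i <;> rfl
  have e2 : (![α, γ, β] ∘ Equiv.swap (1 : Fin 3) 2) = ![α, β, γ] := by
    funext i; fin_cases i <;> rfl
  rw [e1] at h1
  rw [e2] at h2
  rw [h2, h1, neg_neg]

end Algebra

section Manifold

variable {m : ℕ} {M : Type*} [TopologicalSpace M] [ChartedSpace (EuclideanSpace ℝ (Fin m)) M]

instance (x : M) : FiniteDimensional ℝ (TangentSpace (𝓡 m) x) :=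
  inferInstanceAs (FiniteDimensional ℝ (EuclideanSpace ℝ (Fin m)))

/-- The differential `(df)_x`, as an element of the cotangent space `T*_x M`. -/
def differential (m : ℕ) {M : Type*} [TopologicalSpace M]
    [ChartedSpace (EuclideanSpace ℝ (Fin m)) M] (f : M → ℝ) (x : M) :
    Module.Dual ℝ (TangentSpace (𝓡 m) x) :=
  (mvfderiv (𝓡 m) f x).toLinearMap

/-- The `i`-th local coordinate function of the preferred chart at `x₀`. -/
def coord (m : ℕ) {M : Type*} [TopologicalSpace M]
    [ChartedSpace (EuclideanSpace ℝ (Fin m)) M] (x₀ : M) (i : Fin m) (x : M) : ℝ :=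
  (chartAt (EuclideanSpace ℝ (Fin m)) x₀ x) i

/-- A smooth 3-vector field on `M`: a trivector on each tangent space, whose components
`P (dxⁱ, dxʲ, dxᵏ)` in local coordinates are smooth. -/
structure TrivectorField (m : ℕ) (M : Type*) [TopologicalSpace M]
    [ChartedSpace (EuclideanSpace ℝ (Fin m)) M] where
  toFun : ∀ x : M, Trivector (TangentSpace (𝓡 m) x)
  smooth : ∀ (x₀ : M) (i : Fin 3 → Fin m),
    ContMDiffOn (𝓡 m) 𝓘(ℝ, ℝ) ∞
      (fun x => toFun x fun k => differential m (coord m x₀ (i k)) x)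
      (chartAt (EuclideanSpace ℝ (Fin m)) x₀).source

theorem differential_add {f g : M → ℝ} {x : M} (hf : MDifferentiableAt (𝓡 m) 𝓘(ℝ, ℝ) f x)
    (hg : MDifferentiableAt (𝓡 m) 𝓘(ℝ, ℝ) g x) :
    differential m (f + g) x = differential m f x + differential m g x := by
  simp [differential, mvfderiv_add hf hg]

theorem differential_smul {f : M → ℝ} {x : M} (hf : MDifferentiableAt (𝓡 m) 𝓘(ℝ, ℝ) f x)
    (c : ℝ) : differential m (c • f) x = c • differential m f x := by
  ext v
  simp only [differential, mvfderiv, const_smul_mfderiv hf c]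
  rfl

theorem mdifferentiableAt_smooth (f : C^∞⟮𝓡 m, M; ℝ⟯) (x : M) :
    MDifferentiableAt (𝓡 m) 𝓘(ℝ, ℝ) f x :=
  f.contMDiff.contMDiffAt.mdifferentiableAt (by simp)

variable [IsManifold (𝓡 m) ∞ M]

theorem contMDiffOn_comp_chart_symm (f : C^∞⟮𝓡 m, M; ℝ⟯) (x₀ : M) :
    ContDiffOn ℝ ∞ (f ∘ (chartAt (EuclideanSpace ℝ (Fin m)) x₀).symm)
      (chartAt (EuclideanSpace ℝ (Fin m)) x₀).target :=
  (f.contMDiff.comp_contMDiffOn (contMDiffOn_chart_symm (I := 𝓡 m) (x := x₀))).contDiffOn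

theorem mfderiv_eq_comp_chart {F : Type*} [NormedAddCommGroup F] [NormedSpace ℝ F]
    (g : EuclideanSpace ℝ (Fin m) → F) (x₀ : M) {x : M}
    (hx : x ∈ (chartAt (EuclideanSpace ℝ (Fin m)) x₀).source)
    (hg : DifferentiableAt ℝ g (chartAt (EuclideanSpace ℝ (Fin m)) x₀ x))
    (v : TangentSpace (𝓡 m) x) :
    mvfderiv (𝓡 m) (g ∘ chartAt (EuclideanSpace ℝ (Fin m)) x₀) x v =
      fderiv ℝ g (chartAt (EuclideanSpace ℝ (Fin m)) x₀ x)
        (mfderiv (𝓡 m) (𝓡 m) (chartAt (EuclideanSpace ℝ (Fin m)) x₀) x v) := by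
  have hφ : MDifferentiableAt (𝓡 m) (𝓡 m) (chartAt (EuclideanSpace ℝ (Fin m)) x₀) x :=
    ((contMDiffOn_chart (I := 𝓡 m) (n := ∞) (x := x₀)).contMDiffAt
      ((chartAt (EuclideanSpace ℝ (Fin m)) x₀).open_source.mem_nhds hx)).mdifferentiableAt
      (by simp)
  have h := mfderiv_comp x (I'' := 𝓘(ℝ, F)) hg.mdifferentiableAt hφ
  rw [mvfderiv, h, mfderiv_eq_fderiv]
  rfl

/-- In local coordinates, `df = ∑ᵢ (∂f/∂xⁱ) dxⁱ`. -/
theorem differential_eq_sum (f : C^∞⟮𝓡 m, M; ℝ⟯) (x₀ : M) {x : M}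
    (hx : x ∈ (chartAt (EuclideanSpace ℝ (Fin m)) x₀).source) :
    differential m f x = ∑ i : Fin m,
      fderiv ℝ (f ∘ (chartAt (EuclideanSpace ℝ (Fin m)) x₀).symm)
        (chartAt (EuclideanSpace ℝ (Fin m)) x₀ x) (EuclideanSpace.single i 1) •
        differential m (coord m x₀ i) x := by
  have hdiff : DifferentiableAt ℝ (f ∘ (chartAt (EuclideanSpace ℝ (Fin m)) x₀).symm)
      (chartAt (EuclideanSpace ℝ (Fin m)) x₀ x) :=
    ((contMDiffOn_comp_chart_symm f x₀).contDiffAt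
      ((chartAt (EuclideanSpace ℝ (Fin m)) x₀).open_target.mem_nhds
        ((chartAt (EuclideanSpace ℝ (Fin m)) x₀).map_source hx))).differentiableAt (by simp)
  have hev : (f : M → ℝ) =ᶠ[nhds x] (f ∘ (chartAt (EuclideanSpace ℝ (Fin m)) x₀).symm) ∘
      chartAt (EuclideanSpace ℝ (Fin m)) x₀ := by
    filter_upwards [(chartAt (EuclideanSpace ℝ (Fin m)) x₀).open_source.mem_nhds hx] with y hy
    simp [(chartAt (EuclideanSpace ℝ (Fin m)) x₀).left_inv hy]
  have hf : ∀ v, mvfderiv (𝓡 m) f x v =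
      fderiv ℝ (f ∘ (chartAt (EuclideanSpace ℝ (Fin m)) x₀).symm)
        (chartAt (EuclideanSpace ℝ (Fin m)) x₀ x)
        (mfderiv (𝓡 m) (𝓡 m) (chartAt (EuclideanSpace ℝ (Fin m)) x₀) x v) := by
    intro v
    rw [← mfderiv_eq_comp_chart _ x₀ hx hdiff v, mvfderiv, mvfderiv, hev.mfderiv_eq]
    rfl
  have hc : ∀ (i : Fin m) (v), mvfderiv (𝓡 m) (coord m x₀ i) x v =
      EuclideanSpace.proj (𝕜 := ℝ) i
        (mfderiv (𝓡 m) (𝓡 m) (chartAt (EuclideanSpace ℝ (Fin m)) x₀) x v) := by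
    intro i v
    have := mfderiv_eq_comp_chart (EuclideanSpace.proj (𝕜 := ℝ) i : EuclideanSpace ℝ (Fin m) → ℝ)
      x₀ hx (EuclideanSpace.proj (𝕜 := ℝ) i).differentiableAt v
    rw [ContinuousLinearMap.fderiv] at this
    exact this
  ext v
  simp only [differential, LinearMap.sum_apply, LinearMap.smul_apply,
    ContinuousLinearMap.coe_coe, hf, hc, smul_eq_mul]
  set w : EuclideanSpace ℝ (Fin m) :=
    mfderiv (𝓡 m) (𝓡 m) (chartAt (EuclideanSpace ℝ (Fin m)) x₀) x v with hw
  have hsum : w = ∑ i : Fin m, w i • EuclideanSpace.single i (1 : ℝ) := by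
    ext j
    simp [Pi.single_apply]
  conv_lhs => rw [hsum]
  rw [map_sum]
  refine Finset.sum_congr rfl fun i _ => ?_
  rw [map_smul, smul_eq_mul, mul_comm]
  rfl

theorem contMDiffOn_partial (f : C^∞⟮𝓡 m, M; ℝ⟯) (x₀ : M) (i : Fin m) :
    ContMDiffOn (𝓡 m) 𝓘(ℝ, ℝ) ∞
      (fun x => fderiv ℝ (f ∘ (chartAt (EuclideanSpace ℝ (Fin m)) x₀).symm)
        (chartAt (EuclideanSpace ℝ (Fin m)) x₀ x) (EuclideanSpace.single i 1))
      (chartAt (EuclideanSpace ℝ (Fin m)) x₀).source := by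
  have h := (contMDiffOn_comp_chart_symm f x₀).fderiv_of_isOpen (m := ∞)
    (chartAt (EuclideanSpace ℝ (Fin m)) x₀).open_target (by simp)
  have h2 := h.clm_apply (contDiffOn_const (c := EuclideanSpace.single i (1 : ℝ)))
  exact h2.contMDiffOn.comp (contMDiffOn_chart (I := 𝓡 m) (n := ∞) (x := x₀))
    fun y hy => (chartAt (EuclideanSpace ℝ (Fin m)) x₀).map_source hy

namespace TrivectorField

theorem contMDiff_apply (P : TrivectorField m M) (f : Fin 3 → C^∞⟮𝓡 m, M; ℝ⟯) :
    ContMDiff (𝓡 m) 𝓘(ℝ, ℝ) ∞ (fun x => P.toFun x fun k => differential m (f k) x) := by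
  intro x₀
  have hs := chart_source_mem_nhds (EuclideanSpace ℝ (Fin m)) x₀
  refine ContMDiffOn.contMDiffAt (s := (chartAt (EuclideanSpace ℝ (Fin m)) x₀).source) ?_ hs
  have key : ∀ x ∈ (chartAt (EuclideanSpace ℝ (Fin m)) x₀).source,
      (P.toFun x fun k => differential m (f k) x) =
      ∑ r : Fin 3 → Fin m,
        (∏ k, fderiv ℝ (f k ∘ (chartAt (EuclideanSpace ℝ (Fin m)) x₀).symm)
          (chartAt (EuclideanSpace ℝ (Fin m)) x₀ x) (EuclideanSpace.single (r k) 1)) *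
        P.toFun x fun k => differential m (coord m x₀ (r k)) x := by
    intro x hx
    simp only [differential_eq_sum _ x₀ hx]
    refine ((P.toFun x).toMultilinearMap.map_sum _).trans (Finset.sum_congr rfl fun r _ => ?_)
    exact (P.toFun x).toMultilinearMap.map_smul_univ _ _
  refine ContMDiffOn.congr ?_ key
  refine contMDiffOn_finsetSum fun r _ => ContMDiffOn.mul ?_ (P.smooth x₀ r)
  exact contMDiffOn_finsetProd fun k _ => contMDiffOn_partial (f k) x₀ (r k)

/-- The bracket `{f₁, f₂, f₃} = P (df₁, df₂, df₃)` on `C^∞(M)`; it is an alternating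
(i.e. skew-symmetric) trilinear operation. -/
def bracket (P : TrivectorField m M) :
    C^∞⟮𝓡 m, M; ℝ⟯ [⋀^Fin 3]→ₗ[ℝ] C^∞⟮𝓡 m, M; ℝ⟯ where
  toFun f := ⟨fun x => P.toFun x fun k => differential m (f k) x, P.contMDiff_apply f⟩
  map_update_add' {_} f i g h := by
    ext x
    have e : ∀ a : C^∞⟮𝓡 m, M; ℝ⟯, (fun k => differential m (Function.update f i a k) x) =
        Function.update (fun k => differential m (f k) x) i (differential m a x) :=
      fun a => by
        funext k
        by_cases hk : k = i
        · subst hk; simp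
        · simp [hk]
    change P.toFun x (fun k => differential m (Function.update f i (g + h) k) x) =
      P.toFun x (fun k => differential m (Function.update f i g k) x) +
        P.toFun x (fun k => differential m (Function.update f i h k) x)
    rw [e, e, e, ContMDiffMap.coe_add, differential_add (mdifferentiableAt_smooth g x)
      (mdifferentiableAt_smooth h x), AlternatingMap.map_update_add]
  map_update_smul' {_} f i c g := by
    ext x
    have e : ∀ a : C^∞⟮𝓡 m, M; ℝ⟯, (fun k => differential m (Function.update f i a k) x) =
        Function.update (fun k => differential m (f k) x) i (differential m a x) :=
      fun a => by
        funext k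
        by_cases hk : k = i
        · subst hk; simp
        · simp [hk]
    change P.toFun x (fun k => differential m (Function.update f i (c • g) k) x) =
      c • P.toFun x (fun k => differential m (Function.update f i g k) x)
    rw [e, e, ContMDiffMap.coe_smul, differential_smul (mdifferentiableAt_smooth g x),
      AlternatingMap.map_update_smul]
  map_eq_zero_of_eq' f i j hij hne := by
    ext x
    exact (P.toFun x).map_eq_zero_of_eq _ (by simp [hij]) hne

@[simp]
theorem bracket_apply (P : TrivectorField m M) (f : Fin 3 → C^∞⟮𝓡 m, M; ℝ⟯) (x : M) :
    P.bracket f x = P.toFun x fun k => differential m (f k) x := rfl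

end TrivectorField

/-- The generalized Jacobi identity of order 3:
`∑_σ (sign σ) {{f_σ₁, f_σ₂, f_σ₃}, f_σ₄, f_σ₅} = 0`, the sum being over the symmetric group
`S₅`. -/
def GeneralizedJacobi (b : C^∞⟮𝓡 m, M; ℝ⟯ [⋀^Fin 3]→ₗ[ℝ] C^∞⟮𝓡 m, M; ℝ⟯) : Prop :=
  ∀ f : Fin 5 → C^∞⟮𝓡 m, M; ℝ⟯,
    ∑ σ : Equiv.Perm (Fin 5), (Equiv.Perm.sign σ : ℤ) •
      b ![b ![f (σ 0), f (σ 1), f (σ 2)], f (σ 3), f (σ 4)] = 0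

/-- A ternary Poisson bracket: a bracket of the form `{f₁, f₂, f₃} = P (df₁, df₂, df₃)`
satisfying the generalized Jacobi identity; `P` is the Poisson trivector. -/
def TrivectorField.IsPoisson (P : TrivectorField m M) : Prop :=
  GeneralizedJacobi P.bracket

/-- A (ternary) Nambu–Poisson bracket: a skew-symmetric trilinear operation on `C^∞(M)` which is
a derivation in each entry separately and satisfies the fundamental identity
`{f₁, f₂, {g₁, g₂, g₃}} =
  {{f₁, f₂, g₁}, g₂, g₃} + {g₁, {f₁, f₂, g₂}, g₃} + {g₁, g₂, {f₁, f₂, g₃}}`. -/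
structure IsNambuPoisson (b : C^∞⟮𝓡 m, M; ℝ⟯ [⋀^Fin 3]→ₗ[ℝ] C^∞⟮𝓡 m, M; ℝ⟯) : Prop where
  leibniz : ∀ (h : Fin 3 → C^∞⟮𝓡 m, M; ℝ⟯) (i : Fin 3) (f g : C^∞⟮𝓡 m, M; ℝ⟯),
    b (Function.update h i (f * g)) =
      f * b (Function.update h i g) + g * b (Function.update h i f)
  fundamental : ∀ f₁ f₂ g₁ g₂ g₃ : C^∞⟮𝓡 m, M; ℝ⟯,
    b ![f₁, f₂, b ![g₁, g₂, g₃]] =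
      b ![b ![f₁, f₂, g₁], g₂, g₃] + b ![g₁, b ![f₁, f₂, g₂], g₃] +
        b ![g₁, g₂, b ![f₁, f₂, g₃]]

/-- The (possibly singular) distribution `im ♯_P`: the subspace `im ♯_{P_x} ⊆ T_x M` at each
point `x`. -/
def TrivectorField.imSharp (P : TrivectorField m M) (x : M) :
    Submodule ℝ (TangentSpace (𝓡 m) x) :=
  LinearMap.range (sharp (P.toFun x))

/-- A (possibly singular) distribution `D` is involutive if the Lie bracket of any two smooth
vector fields, defined on the same open set and tangent to `D`, is tangent to `D`. -/
def IsInvolutive (D : ∀ x : M, Submodule ℝ (TangentSpace (𝓡 m) x)) : Prop :=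
  ∀ (U : Set M), IsOpen U → ∀ X Y : ∀ x : M, TangentSpace (𝓡 m) x,
    ContMDiffOn (𝓡 m) (𝓡 m).tangent ∞ (fun x => (⟨x, X x⟩ : TangentBundle (𝓡 m) M)) U →
    ContMDiffOn (𝓡 m) (𝓡 m).tangent ∞ (fun x => (⟨x, Y x⟩ : TangentBundle (𝓡 m) M)) U →
    (∀ x ∈ U, X x ∈ D x) → (∀ x ∈ U, Y x ∈ D x) →
    ∀ x ∈ U, VectorField.mlieBracket (𝓡 m) X Y x ∈ D x

end Manifold

end NambuPoisson

end

/-! The generalized Jacobi identity constrains `P` pointwise. Fix `x` and a covector `a`, and take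
one of the five functions to be `u²/2` with `u x = 0` and `du = a` at `x`. Its differential vanishes
at `x`, so only terms with it inside the inner bracket survive, and what remains is the Plücker
relation for the bivector `i(a)P` (`IsPoisson.hasDecomposableContractions`). Polarizing in `a` shows
that `P` itself is decomposable (`plucker_of_contraction`). Hence where `F = {a,b,c}` is nonzero,
the image of `♯_P` has the Hamiltonian fields of `(b,c)`, `(c,a)`, `(a,b)` as a frame, and `F · v(f)
= v(a){b,c,f} + v(b){c,a,f} + v(c){a,b,f}` characterizes its vectors `v` (`apply_mem_imSharp`,
`mem_imSharp`).

If the fundamental identity holds, the commutators of these frame fields lie in the image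
(`frame_commutator`), and Leibniz extends this to all fields tangent to it. At a zero of `P`,
tangent fields vanish, and so does their Lie bracket.

Conversely, let the image be involutive. The defect of the fundamental identity, as a function of
its last argument, is then the derivative along a vector of the image (`exists_defect_eq`). It is
alternating in the `g`'s, so where `{f₁,f₂,f₃} ≠ 0` it is determined by its value on `(f₁,f₂,f₃)`,
which vanishes for formal reasons (`defect_self`). Additivity in `f₁` and `f₂` removes the
nonvanishing condition at points with `P ≠ 0`. At zeros of `P` every term vanishes. -/

namespace NambuPoisson

/-! ### Decomposability of a trivector from its contractions. -/

section Algebra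

/-- The Plücker relation of a skew-symmetric trilinear function all of whose contractions with a
single argument have rank at most two. -/
theorem plucker_of_contraction {V : Type*} [Add V] (p : V → V → V → ℝ)
    (hadd : ∀ a b c d, p (a + b) c d = p a c d + p b c d)
    (h₁ : ∀ a b c, p b a c = -p a b c) (h₂ : ∀ a b c, p a c b = -p a b c)
    (hdec : ∀ a b c d e, p a b c * p a d e - p a b d * p a c e + p a b e * p a c d = 0)
    {a b c : V} (h : p a b c ≠ 0) (u v w : V) :
    p a b c * p u v w = p u v a * p b c w + p u v b * p c a w + p u v c * p a b w := by
  have hca : ∀ x, p c a x = -p a c x := fun x => h₁ a c x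
  have hbac : p b a c = -p a b c := h₁ a b c
  have hcab : p c a b = p a b c := by rw [h₁ a c b, h₂ a b c, neg_neg]
  have hua : ∀ x y, p x y a = p a x y := fun x y => by rw [h₂ x a y, h₁ a x y, neg_neg]
  have hub : ∀ x y, p x y b = p b x y := fun x y => by rw [h₂ x b y, h₁ b x y, neg_neg]
  have huc : ∀ x y, p x y c = p c x y := fun x y => by rw [h₂ x c y, h₁ c x y, neg_neg]
  -- The relation `hdec` is quadratic in its first argument; this is its polarization.
  have pol : ∀ a' b c d e,
      p a b c * p a' d e - p a b d * p a' c e + p a b e * p a' c d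
        + (p a' b c * p a d e - p a' b d * p a c e + p a' b e * p a c d) = 0 := by
    intro a' b c d e
    have h0 := hdec (a + a') b c d e
    simp only [hadd] at h0
    linear_combination h0 - hdec a b c d e - hdec a' b c d e
  -- `ea`, `eb`, `ec` express values with one entry among `a`, `b`, `c` through values with two such
  -- entries.
  have ea : ∀ x y, p a b c * p a x y = p a b x * p a c y - p a b y * p a c x := fun x y => by
    linear_combination hdec a b c x y
  have eb : ∀ x y, p a b c * p b x y = p a b x * p b c y - p a b y * p b c x := fun x y => by
    have := hdec b a c x y
    rw [hbac, h₁ a b x, h₁ a b y] at this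
    linear_combination -this
  have ec : ∀ x y, p a b c * p c x y = p a c x * p b c y - p a c y * p b c x := fun x y => by
    have := hdec c a b x y
    rw [hcab, h₁ a c x, h₁ a c y, h₁ b c x, h₁ b c y] at this
    linear_combination this
  have key := pol u b c v w
  rw [hua u v, hub u v, huc u v, hca w]
  have e1 : p u b c = p b c u := by rw [h₁ b u c, h₂ b c u, neg_neg]
  have e2 : ∀ x, p u b x = -p b u x := fun x => h₁ b u x
  have e3 : ∀ x, p u c x = -p c u x := fun x => h₁ c u x
  rw [e1, e2, e2, e3, e3] at key
  -- The extra factor `p a b c` lets `ea`, `eb`, `ec` be substituted into the polarized relation.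
  apply mul_left_cancel₀ h
  linear_combination p a b c * key - p b c w * ea u v - p a b v * ec u w - p b c u * ea v w
    + p a c v * eb u w

end Algebra

end NambuPoisson

namespace NambuPoisson

/-! ### Signed sums over symmetric groups. -/

section Permutations
open Equiv

/-- Each of the three pairings of four indices comes from eight permutations: swaps within the pairs
are compensated by the skewness of `q`, and exchanging the pairs is even. -/
theorem sum_perm_four_sign (q : Fin 5 → Fin 5 → ℝ) (hs : ∀ i j, q j i = -q i j) :
    ∑ e : Perm (Fin 4), ((Perm.sign e : ℤ) : ℝ) *
        (q (e 0).succ (e 1).succ * q (e 2).succ (e 3).succ) =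
      8 * (q 1 2 * q 3 4 - q 1 3 * q 2 4 + q 1 4 * q 2 3) := by
  -- Numerals become successors so that the `decomposeFin` evaluation lemmas apply.
  have e₂ : (2 : Fin 4) = Fin.succ 1 := rfl
  have e₃ : (3 : Fin 4) = Fin.succ 2 := rfl
  have e₂' : (2 : Fin 3) = Fin.succ 1 := rfl
  rw [e₃, e₂, e₂']
  simp only [Finset.univ_perm_fin_succ, ← Finset.univ_product_univ, Finset.sum_map,
    Finset.sum_product, Fin.sum_univ_succ, Equiv.coe_toEmbedding,
    Perm.decomposeFin.symm_sign, Perm.decomposeFin_symm_apply_zero,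
    Perm.decomposeFin_symm_apply_one, Perm.decomposeFin_symm_apply_succ]
  simp [swap_apply_def]
  rw [hs 1 2, hs 1 3, hs 1 4, hs 2 3, hs 2 4, hs 3 4]
  ring

/-- A signed sum over `S₅` in which only the permutations with a zero in one of the first three
places contribute. -/
theorem sum_perm_five_sign (ψ : Fin 5 → Fin 5 → Fin 5 → Fin 5 → Fin 5 → ℝ)
    (q : Fin 5 → Fin 5 → ℝ)
    (h₁ : ∀ i j k l m, ψ j i k l m = -ψ i j k l m)
    (h₂ : ∀ i j k l m, ψ k j i l m = -ψ i j k l m)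
    (h₃ : ∀ i j k m, ψ i j k 0 m = 0) (h₄ : ∀ i j k l, ψ i j k l 0 = 0)
    (hq : ∀ i j k l, ψ 0 i j k l = q i j * q k l) (hs : ∀ i j, q j i = -q i j) :
    ∑ σ : Perm (Fin 5), ((Perm.sign σ : ℤ) : ℝ) * ψ (σ 0) (σ 1) (σ 2) (σ 3) (σ 4) =
      24 * (q 1 2 * q 3 4 - q 1 3 * q 2 4 + q 1 4 * q 2 3) := by
  set g : Perm (Fin 5) → ℝ :=
    fun σ => ((Perm.sign σ : ℤ) : ℝ) * ψ (σ 0) (σ 1) (σ 2) (σ 3) (σ 4) with hg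
  -- Sort permutations by the place of `0`; places 3 and 4 contribute nothing by `h₃` and `h₄`.
  have split : ∀ σ : Perm (Fin 5), g σ = (if σ 0 = 0 then g σ else 0) +
      (if σ 1 = 0 then g σ else 0) + (if σ 2 = 0 then g σ else 0) := by
    intro σ
    have inj : ∀ {i j : Fin 5}, σ i = 0 → σ j = 0 → i = j := fun hi hj =>
      σ.injective (hi.trans hj.symm)
    obtain ⟨k, hk⟩ := σ.surjective 0
    have hne : ∀ j, j ≠ k → σ j ≠ 0 := fun j hj h => hj (inj h hk)
    fin_cases k
    · simp [hne 1 (by decide), hne 2 (by decide), show σ 0 = 0 from hk]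
    · simp [hne 0 (by decide), hne 2 (by decide), show σ 1 = 0 from hk]
    · simp [hne 0 (by decide), hne 1 (by decide), show σ 2 = 0 from hk]
    · have hk' : σ 3 = 0 := hk
      simp [hg, hk', h₃]
    · have hk' : σ 4 = 0 := hk
      simp [hg, hk', h₄]
  -- Precomposing with a transposition changes both the sign and `ψ`, so each of the three places
  -- contributes the same: `24 = 3 · 8`.
  have sum_one : ∑ σ, (if σ 1 = 0 then g σ else 0) = ∑ σ, (if σ 0 = 0 then g σ else 0) := by
    refine (Equiv.sum_comp (Equiv.mulRight (swap (0 : Fin 5) 1)) _).symm.trans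
      (Finset.sum_congr rfl fun σ _ => ?_)
    have e : g (σ * swap 0 1) = g σ := by
      simp only [hg, Perm.mul_apply, swap_apply_left, swap_apply_right,
        swap_apply_of_ne_of_ne (show (2 : Fin 5) ≠ 0 by decide) (show (2 : Fin 5) ≠ 1 by decide),
        swap_apply_of_ne_of_ne (show (3 : Fin 5) ≠ 0 by decide) (show (3 : Fin 5) ≠ 1 by decide),
        swap_apply_of_ne_of_ne (show (4 : Fin 5) ≠ 0 by decide) (show (4 : Fin 5) ≠ 1 by decide)]
      rw [Perm.sign_mul, Perm.sign_swap (by decide), h₁]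
      simp
    simp [e]
  have sum_two : ∑ σ, (if σ 2 = 0 then g σ else 0) = ∑ σ, (if σ 0 = 0 then g σ else 0) := by
    refine (Equiv.sum_comp (Equiv.mulRight (swap (0 : Fin 5) 2)) _).symm.trans
      (Finset.sum_congr rfl fun σ _ => ?_)
    have e : g (σ * swap 0 2) = g σ := by
      simp only [hg, Perm.mul_apply, swap_apply_left, swap_apply_right,
        swap_apply_of_ne_of_ne (show (1 : Fin 5) ≠ 0 by decide) (show (1 : Fin 5) ≠ 2 by decide),
        swap_apply_of_ne_of_ne (show (3 : Fin 5) ≠ 0 by decide) (show (3 : Fin 5) ≠ 2 by decide),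
        swap_apply_of_ne_of_ne (show (4 : Fin 5) ≠ 0 by decide) (show (4 : Fin 5) ≠ 2 by decide)]
      rw [Perm.sign_mul, Perm.sign_swap (by decide), h₂]
      simp
    simp [e]
  have sum_zero : ∑ σ, (if σ 0 = 0 then g σ else 0) =
      ∑ e : Perm (Fin 4), ((Perm.sign e : ℤ) : ℝ) *
        (q (e 0).succ (e 1).succ * q (e 2).succ (e 3).succ) := by
    rw [Finset.univ_perm_fin_succ, ← Finset.univ_product_univ, Finset.sum_map, Finset.sum_product,
      Finset.sum_eq_single 0]
    · refine Finset.sum_congr rfl fun e _ => ?_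
      have hsucc : ∀ x : Fin 4, Perm.decomposeFin.symm (0, e) x.succ = (e x).succ := fun x => by
        rw [Perm.decomposeFin_symm_apply_succ, swap_self]; rfl
      have h0 : Perm.decomposeFin.symm (0, e) 0 = 0 := Perm.decomposeFin_symm_apply_zero 0 e
      have hsign : Perm.sign (Perm.decomposeFin.symm (0, e)) = Perm.sign e := by
        rw [Perm.decomposeFin.symm_sign]; simp
      have e1 := hsucc 0
      have e2 := hsucc 1
      have e3 := hsucc 2
      have e4 := hsucc 3
      change Perm.decomposeFin.symm (0, e) 1 = _ at e1
      change Perm.decomposeFin.symm (0, e) 2 = _ at e2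
      change Perm.decomposeFin.symm (0, e) 3 = _ at e3
      change Perm.decomposeFin.symm (0, e) 4 = _ at e4
      simp only [Equiv.coe_toEmbedding, hg]
      rw [if_pos h0, h0, e1, e2, e3, e4, hsign, hq]
    · intro p _ hp
      refine Finset.sum_eq_zero fun e _ => ?_
      simp only [Equiv.coe_toEmbedding, Perm.decomposeFin_symm_apply_zero, if_neg hp]
    · simp
  rw [Finset.sum_congr rfl fun σ _ => split σ, Finset.sum_add_distrib, Finset.sum_add_distrib,
    sum_one, sum_two, sum_zero, sum_perm_four_sign q hs]
  ring

end Permutations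

end NambuPoisson

noncomputable section

namespace NambuPoisson

open scoped Topology
open VectorField

/-! ### Differentials and global functions with prescribed germs. -/

section Differentials

variable {m : ℕ} {M : Type*} [TopologicalSpace M] [ChartedSpace (EuclideanSpace ℝ (Fin m)) M]

theorem differential_congr {f g : M → ℝ} {x : M} (h : f =ᶠ[𝓝 x] g) :
    differential m f x = differential m g x := by
  ext v
  simp only [differential, mvfderiv, h.mfderiv_eq]
  rw [ContinuousLinearMap.coe_coe, ContinuousLinearMap.coe_coe]
  rfl

theorem differential_mul {f g : M → ℝ} {x : M} (hf : MDifferentiableAt (𝓡 m) 𝓘(ℝ, ℝ) f x)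
    (hg : MDifferentiableAt (𝓡 m) 𝓘(ℝ, ℝ) g x) :
    differential m (f * g) x = f x • differential m g x + g x • differential m f x := by
  simp [differential, mvfderiv_mul hf hg]

variable [IsManifold (𝓡 m) ∞ M]

theorem differential_comp_chart (g : EuclideanSpace ℝ (Fin m) →ₗ[ℝ] ℝ) (x : M)
    (v : TangentSpace (𝓡 m) x) :
    differential m (g ∘ chartAt (EuclideanSpace ℝ (Fin m)) x) x v = g v := by
  have h := mfderiv_eq_comp_chart (LinearMap.toContinuousLinearMap g) x
    (mem_chart_source (EuclideanSpace ℝ (Fin m)) x)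
    (LinearMap.toContinuousLinearMap g).differentiableAt v
  rw [ContinuousLinearMap.fderiv] at h
  -- The preferred chart at `x` has identity derivative there, by the way `TangentSpace` is
  -- modelled.
  have h' : mfderiv (𝓡 m) (𝓡 m) (chartAt (EuclideanSpace ℝ (Fin m)) x) x v = v := by
    have := mfderiv_extChartAt_self (I := 𝓡 m) (x := x)
    simp only [mfld_simps] at this
    exact congrArg (fun L : EuclideanSpace ℝ (Fin m) →L[ℝ] EuclideanSpace ℝ (Fin m) => L v) this
  rw [h'] at h
  exact h

variable [T2Space M]

/-- Multiply by a bump function supported in the chart; `T2Space` is needed to extend by zero. -/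
theorem exists_smooth_eventuallyEq {u : M → ℝ} {x : M}
    (hu : ContMDiffOn (𝓡 m) 𝓘(ℝ, ℝ) ∞ u (chartAt (EuclideanSpace ℝ (Fin m)) x).source) :
    ∃ f : C^∞⟮𝓡 m, M; ℝ⟯, f =ᶠ[𝓝 x] u := by
  let b : SmoothBumpFunction (𝓡 m) x := Classical.arbitrary _
  refine ⟨⟨fun y => b y • u y, b.contMDiff_smul hu⟩, ?_⟩
  filter_upwards [b.eventuallyEq_one] with y hy
  change b y • u y = u y
  rw [hy]
  simp

theorem exists_smooth_eventuallyEq_coord (x : M) (i : Fin m) :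
    ∃ f : C^∞⟮𝓡 m, M; ℝ⟯, f =ᶠ[𝓝 x] coord m x i := by
  apply exists_smooth_eventuallyEq
  exact (EuclideanSpace.proj (𝕜 := ℝ) i).contMDiff.comp_contMDiffOn
    (contMDiffOn_chart (I := 𝓡 m) (n := ∞) (x := x))

/-- Extend the covector, read as a linear form in the chart, and subtract a constant. The
normalization `f x = 0` makes products of such functions vanish to second order. -/
theorem exists_differential_eq (x : M) (α : Module.Dual ℝ (TangentSpace (𝓡 m) x)) :
    ∃ f : C^∞⟮𝓡 m, M; ℝ⟯, f x = 0 ∧ differential m f x = α := by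
  let α' : EuclideanSpace ℝ (Fin m) →ₗ[ℝ] ℝ := α
  obtain ⟨f, hf⟩ := exists_smooth_eventuallyEq (m := m) (x := x)
    (u := α' ∘ chartAt (EuclideanSpace ℝ (Fin m)) x)
    ((LinearMap.toContinuousLinearMap α').contMDiff.comp_contMDiffOn
      (contMDiffOn_chart (I := 𝓡 m) (n := ∞) (x := x)))
  have hd : differential m f x = α := by
    rw [differential_congr hf]
    ext v
    exact differential_comp_chart α' x v
  refine ⟨f - ContMDiffMap.const (f x), sub_self (f x), ?_⟩
  rw [← hd]
  ext v
  change mvfderiv (𝓡 m) ((f : M → ℝ) - fun _ => f x) x v = mvfderiv (𝓡 m) f x v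
  rw [mvfderiv_sub (mdifferentiableAt_smooth f x) mdifferentiableAt_const, mvfderiv_const, sub_zero]

end Differentials

/-! ### The Lie bracket as a commutator of derivations. -/

section LieBracket

variable {m : ℕ} {M : Type*} [TopologicalSpace M] [ChartedSpace (EuclideanSpace ℝ (Fin m)) M]
  [IsManifold (𝓡 m) ∞ M]

/-- The derivative `Y f` of a smooth function along a vector field, in the preferred chart. -/
theorem differential_apply_symm (f : C^∞⟮𝓡 m, M; ℝ⟯) (Y : ∀ y : M, TangentSpace (𝓡 m) y) (x : M)
    {e : EuclideanSpace ℝ (Fin m)} (he : e ∈ (extChartAt (𝓡 m) x).target) :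
    fderiv ℝ (f ∘ (extChartAt (𝓡 m) x).symm) e
      (mpullback 𝓘(ℝ, EuclideanSpace ℝ (Fin m)) (𝓡 m) (extChartAt (𝓡 m) x).symm Y e) =
    differential m f ((extChartAt (𝓡 m) x).symm e) (Y ((extChartAt (𝓡 m) x).symm e)) := by
  have : IsManifold (𝓡 m) 1 M := IsManifold.of_le (n := ∞) (by simp)
  have hφ : MDifferentiableAt 𝓘(ℝ, EuclideanSpace ℝ (Fin m)) (𝓡 m)
      (extChartAt (𝓡 m) x).symm e := by
    have := mdifferentiableWithinAt_extChartAt_symm (I := 𝓡 m) he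
    rwa [ModelWithCorners.range_eq_univ, mdifferentiableWithinAt_univ] at this
  have hinv := isInvertible_mfderivWithin_extChartAt_symm (I := 𝓡 m) he
  rw [ModelWithCorners.range_eq_univ, mfderivWithin_univ] at hinv
  have hcomp := mfderiv_comp e
    (mdifferentiableAt_smooth f ((extChartAt (𝓡 m) x).symm e)) hφ
  rw [mfderiv_eq_fderiv] at hcomp
  have h := congrArg (fun L => L (mpullback 𝓘(ℝ, EuclideanSpace ℝ (Fin m)) (𝓡 m)
    (extChartAt (𝓡 m) x).symm Y e)) hcomp
  refine h.trans ?_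
  change mfderiv (𝓡 m) 𝓘(ℝ, ℝ) f ((extChartAt (𝓡 m) x).symm e)
    (mfderiv 𝓘(ℝ, EuclideanSpace ℝ (Fin m)) (𝓡 m) (extChartAt (𝓡 m) x).symm e
      (mpullback 𝓘(ℝ, EuclideanSpace ℝ (Fin m)) (𝓡 m) (extChartAt (𝓡 m) x).symm Y e)) = _
  rw [mpullback_apply, hinv.self_apply_inverse]
  rfl

/-- The derivative `Y f` of a smooth function along a vector field, near a point. -/
theorem differential_apply_eventuallyEq (f : C^∞⟮𝓡 m, M; ℝ⟯)
    (Y : ∀ y : M, TangentSpace (𝓡 m) y) (x : M) :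
    (fun y => differential m f y (Y y)) ∘ (extChartAt (𝓡 m) x).symm =ᶠ[𝓝 (extChartAt (𝓡 m) x x)]
      fun e => fderiv ℝ (f ∘ (extChartAt (𝓡 m) x).symm) e
        (mpullback 𝓘(ℝ, EuclideanSpace ℝ (Fin m)) (𝓡 m) (extChartAt (𝓡 m) x).symm Y e) := by
  filter_upwards [extChartAt_target_mem_nhds (I := 𝓡 m) x] with e he
  exact (differential_apply_symm f Y x he).symm

theorem contDiffAt_comp_extChartAt_symm (f : C^∞⟮𝓡 m, M; ℝ⟯) (x : M) :
    ContDiffAt ℝ ∞ (f ∘ (extChartAt (𝓡 m) x).symm) (extChartAt (𝓡 m) x x) :=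
  (contMDiffOn_comp_chart_symm f x).contDiffAt
    ((chartAt (EuclideanSpace ℝ (Fin m)) x).open_target.mem_nhds
      (mem_chart_target (EuclideanSpace ℝ (Fin m)) x))

omit [IsManifold (𝓡 m) ∞ M] in
theorem fderiv_comp_symm {g : M → ℝ} {x : M} (hg : MDifferentiableAt (𝓡 m) 𝓘(ℝ, ℝ) g x)
    (v : TangentSpace (𝓡 m) x) :
    fderiv ℝ (g ∘ (extChartAt (𝓡 m) x).symm) (extChartAt (𝓡 m) x x) v = differential m g x v := by
  simp [differential, mvfderiv, hg.mfderiv]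
  rfl

variable {X Y : ∀ y : M, TangentSpace (𝓡 m) y} {x : M}

theorem differentiableAt_mpullback_symm
    (hY : MDifferentiableAt (𝓡 m) (𝓡 m).tangent
      (fun y => (⟨y, Y y⟩ : TangentBundle (𝓡 m) M)) x) :
    DifferentiableAt ℝ (fun e : EuclideanSpace ℝ (Fin m) =>
      (mpullback 𝓘(ℝ, EuclideanSpace ℝ (Fin m)) (𝓡 m) (extChartAt (𝓡 m) x).symm Y e :
        EuclideanSpace ℝ (Fin m))) (extChartAt (𝓡 m) x x) := by
  have : IsManifold (𝓡 m) 2 M := IsManifold.of_le (n := ∞) (WithTop.coe_le_coe.2 le_top)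
  have := MDifferentiableWithinAt.differentiableWithinAt_mpullbackWithin_vectorField
    hY.mdifferentiableWithinAt (s := Set.univ)
  rw [ModelWithCorners.range_eq_univ, Set.preimage_univ, Set.inter_univ,
    mpullbackWithin_univ] at this
  exact differentiableWithinAt_univ.1 this

theorem mdifferentiableAt_differential_apply (f : C^∞⟮𝓡 m, M; ℝ⟯)
    (hY : MDifferentiableAt (𝓡 m) (𝓡 m).tangent
      (fun y => (⟨y, Y y⟩ : TangentBundle (𝓡 m) M)) x) :
    MDifferentiableAt (𝓡 m) 𝓘(ℝ, ℝ) (fun y => differential m f y (Y y)) x := by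
  have : IsManifold (𝓡 m) 1 M := IsManifold.of_le (n := ∞) (by simp)
  have h : DifferentiableAt ℝ (fun e => fderiv ℝ (f ∘ (extChartAt (𝓡 m) x).symm) e
      (mpullback 𝓘(ℝ, EuclideanSpace ℝ (Fin m)) (𝓡 m) (extChartAt (𝓡 m) x).symm Y e))
      (extChartAt (𝓡 m) x x) :=
    (((contDiffAt_comp_extChartAt_symm f x).fderiv_right (m := 1) (WithTop.coe_le_coe.2 le_top)).differentiableAt
      (by simp)).clm_apply (differentiableAt_mpullback_symm hY)
  have h2 := h.mdifferentiableAt.comp x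
    (mdifferentiableAt_extChartAt (I := 𝓡 m) (mem_chart_source (EuclideanSpace ℝ (Fin m)) x))
  refine h2.congr_of_eventuallyEq ?_
  filter_upwards [extChartAt_source_mem_nhds (I := 𝓡 m) x] with y hy
  have := differential_apply_symm f Y x ((extChartAt (𝓡 m) x).map_source hy)
  rw [(extChartAt (𝓡 m) x).left_inv hy] at this
  exact this.symm

/-- The Lie bracket acts on smooth functions as the commutator of derivations. -/
theorem differential_mlieBracket (f : C^∞⟮𝓡 m, M; ℝ⟯)
    (hX : MDifferentiableAt (𝓡 m) (𝓡 m).tangent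
      (fun y => (⟨y, X y⟩ : TangentBundle (𝓡 m) M)) x)
    (hY : MDifferentiableAt (𝓡 m) (𝓡 m).tangent
      (fun y => (⟨y, Y y⟩ : TangentBundle (𝓡 m) M)) x) :
    differential m f x (mlieBracket (𝓡 m) X Y x) =
      differential m (fun y => differential m f y (Y y)) x (X x) -
        differential m (fun y => differential m f y (X y)) x (Y x) := by
  have : IsManifold (𝓡 m) 1 M := IsManifold.of_le (n := ∞) (by simp)
  have hb : mlieBracket (𝓡 m) X Y x = lieBracket ℝ
      (mpullback 𝓘(ℝ, EuclideanSpace ℝ (Fin m)) (𝓡 m) (extChartAt (𝓡 m) x).symm X)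
      (mpullback 𝓘(ℝ, EuclideanSpace ℝ (Fin m)) (𝓡 m) (extChartAt (𝓡 m) x).symm Y)
      (extChartAt (𝓡 m) x x) := by
    have hinv := isInvertible_mfderiv_extChartAt (I := 𝓡 m) (mem_extChartAt_source (I := 𝓡 m) x)
    rw [← mlieBracketWithin_univ, mlieBracketWithin_apply]
    refine hinv.inverse_apply_eq.2 (Eq.trans ?_ (congrArg (fun L : EuclideanSpace ℝ (Fin m) →L[ℝ]
      EuclideanSpace ℝ (Fin m) => L _) (mfderiv_extChartAt_self (I := 𝓡 m) (x := x))).symm)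
    rw [ModelWithCorners.range_eq_univ, Set.preimage_univ, Set.inter_univ, mpullbackWithin_univ,
      mpullbackWithin_univ]
    exact congrFun (lieBracketWithin_univ (E := EuclideanSpace ℝ (Fin m))) _
  have hpull : ∀ Z : ∀ y : M, TangentSpace (𝓡 m) y,
      mpullback 𝓘(ℝ, EuclideanSpace ℝ (Fin m)) (𝓡 m) (extChartAt (𝓡 m) x).symm Z
        (extChartAt (𝓡 m) x x) = Z x := by
    intro Z
    have h := mfderivWithin_extChartAt_symm_inverse_apply (I := 𝓡 m) (x := x)
      (Z ((extChartAt (𝓡 m) x).symm (extChartAt (𝓡 m) x x)))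
    rw [ModelWithCorners.range_eq_univ, mfderivWithin_univ] at h
    refine h.trans ?_
    exact congrArg (fun y => (Z y : EuclideanSpace ℝ (Fin m))) (extChartAt_to_inv (I := 𝓡 m) x)
  -- The vector space identity, resting on symmetry of the second derivative, applied in the
  -- preferred chart.
  have h := fderiv_apply_lieBracket (𝕜 := ℝ) (contDiffAt_comp_extChartAt_symm f x)
    (by simp only [minSmoothness_of_isRCLikeNormedField]; exact WithTop.coe_le_coe.2 le_top)
    (differentiableAt_mpullback_symm hY) (differentiableAt_mpullback_symm hX)
  rw [← (differential_apply_eventuallyEq f X x).fderiv_eq,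
    ← (differential_apply_eventuallyEq f Y x).fderiv_eq] at h
  rw [← fderiv_comp_symm (mdifferentiableAt_smooth f x),
    ← fderiv_comp_symm (mdifferentiableAt_differential_apply f hX),
    ← fderiv_comp_symm (mdifferentiableAt_differential_apply f hY), hb]
  refine h.trans ?_
  congr 2
  · exact hpull X
  · exact hpull Y

end LieBracket

end NambuPoisson

end

noncomputable section

namespace NambuPoisson

open scoped Topology
open VectorField

/-! ### Trivectors with decomposable contractions and the image of `sharp`. -/

section Trivectors

section Alternating

variable {R N N' : Type*} [CommRing R] [AddCommGroup N] [Module R N] [AddCommGroup N'] [Module R N']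

theorem alternating_swap_zero_one (A : N [⋀^Fin 3]→ₗ[R] N') (a b c : N) :
    A ![b, a, c] = -A ![a, b, c] := by
  have h := A.map_swap ![a, b, c] (i := 0) (j := 1) (by decide)
  rwa [show (![a, b, c] ∘ Equiv.swap (0 : Fin 3) 1) = ![b, a, c] by
    funext i; fin_cases i <;> rfl] at h

theorem alternating_swap_one_two (A : N [⋀^Fin 3]→ₗ[R] N') (a b c : N) :
    A ![a, c, b] = -A ![a, b, c] := by
  have h := A.map_swap ![a, b, c] (i := 1) (j := 2) (by decide)
  rwa [show (![a, b, c] ∘ Equiv.swap (1 : Fin 3) 2) = ![a, c, b] by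
    funext i; fin_cases i <;> rfl] at h

theorem alternating_swap_zero_two (A : N [⋀^Fin 3]→ₗ[R] N') (a b c : N) :
    A ![c, b, a] = -A ![a, b, c] := by
  rw [alternating_swap_zero_one, alternating_swap_one_two, alternating_swap_zero_one, neg_neg]

theorem alternating_rotate (A : N [⋀^Fin 3]→ₗ[R] N') (a b c : N) :
    A ![c, a, b] = A ![a, b, c] := by
  rw [alternating_swap_zero_one, alternating_swap_one_two, neg_neg]

theorem update_vec_zero {T : Type*} (a a' b c : T) :
    Function.update ![a, b, c] 0 a' = ![a', b, c] := by
  funext i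
  fin_cases i <;> rfl

theorem alternating_add_zero (A : N [⋀^Fin 3]→ₗ[R] N') (a a' b c : N) :
    A ![a + a', b, c] = A ![a, b, c] + A ![a', b, c] := by
  have h := A.map_update_add ![a, b, c] 0 a a'
  simpa only [update_vec_zero] using h

theorem alternating_smul_zero (A : N [⋀^Fin 3]→ₗ[R] N') (r : R) (a b c : N) :
    A ![r • a, b, c] = r • A ![a, b, c] := by
  have h := A.map_update_smul ![a, b, c] 0 r a
  simpa only [update_vec_zero] using h

theorem alternating_neg_zero (A : N [⋀^Fin 3]→ₗ[R] N') (a b c : N) :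
    A ![-a, b, c] = -A ![a, b, c] := by
  rw [← neg_one_smul R a, alternating_smul_zero, neg_one_smul]

theorem alternating_add_one (A : N [⋀^Fin 3]→ₗ[R] N') (a b b' c : N) :
    A ![a, b + b', c] = A ![a, b, c] + A ![a, b', c] := by
  rw [alternating_swap_zero_one, alternating_add_zero, alternating_swap_zero_one _ a b,
    alternating_swap_zero_one _ a b', neg_add, neg_neg, neg_neg]

theorem alternating_add_two (A : N [⋀^Fin 3]→ₗ[R] N') (a b c c' : N) :
    A ![a, b, c + c'] = A ![a, b, c] + A ![a, b, c'] := by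
  rw [alternating_swap_one_two, alternating_add_one, alternating_swap_one_two _ a b c,
    alternating_swap_one_two _ a b c', neg_add, neg_neg, neg_neg]

theorem alternating_neg_two (A : N [⋀^Fin 3]→ₗ[R] N') (a b c : N) :
    A ![a, b, -c] = -A ![a, b, c] := by
  rw [← alternating_rotate, alternating_neg_zero, alternating_rotate]

theorem alternating_zero_zero (A : N [⋀^Fin 3]→ₗ[R] N') (b c : N) : A ![0, b, c] = 0 :=
  A.map_coord_zero 0 rfl

theorem alternating_zero_one (A : N [⋀^Fin 3]→ₗ[R] N') (a c : N) : A ![a, 0, c] = 0 :=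
  A.map_coord_zero 1 rfl

theorem alternating_zero_two (A : N [⋀^Fin 3]→ₗ[R] N') (a b : N) : A ![a, b, 0] = 0 :=
  A.map_coord_zero 2 rfl

end Alternating

variable {L : Type*} [AddCommGroup L] [Module ℝ L] [FiniteDimensional ℝ L]

/-- A trivector all of whose contractions with a covector are decomposable bivectors. -/
def HasDecomposableContractions (p : Trivector L) : Prop :=
  ∀ a b c d e, p ![a, b, c] * p ![a, d, e] - p ![a, b, d] * p ![a, c, e]
    + p ![a, b, e] * p ![a, c, d] = 0

/-- Linear in `v`, so it suffices to treat `v = ♯(α ∧ β)`, where it is the Plücker relation. -/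
theorem HasDecomposableContractions.apply_mem_range_sharp {p : Trivector L}
    (hp : HasDecomposableContractions p) {v : L} (hv : v ∈ LinearMap.range (sharp p))
    {a b c : Module.Dual ℝ L} (h : p ![a, b, c] ≠ 0) (w : Module.Dual ℝ L) :
    p ![a, b, c] * w v = a v * p ![b, c, w] + b v * p ![c, a, w] + c v * p ![a, b, w] := by
  obtain ⟨l, rfl⟩ := hv
  have hl : l ∈ Submodule.span ℝ (Set.range (exteriorPower.ιMulti ℝ 2)) := by
    rw [exteriorPower.ιMulti_span]; trivial
  induction hl using Submodule.span_induction with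
  | mem l hl =>
    obtain ⟨y, rfl⟩ := hl
    have hy : y = ![y 0, y 1] := by funext i; fin_cases i <;> rfl
    rw [hy]
    simp only [apply_sharp]
    exact plucker_of_contraction (fun a b c => p ![a, b, c]) (fun a a' b c =>
      alternating_add_zero p a a' b c) (alternating_swap_zero_one p) (alternating_swap_one_two p)
      hp h _ _ _
  | zero => simp
  | add l l' _ _ hl hl' =>
    simp only [map_add]
    linear_combination hl + hl'
  | smul r l _ hl =>
    simp only [map_smul, smul_eq_mul]
    linear_combination r * hl

/-- The formula exhibits `p ![a, b, c] • v` as an explicit combination of `♯(b ∧ c)`, `♯(c ∧ a)`,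
`♯(a ∧ b)`; decomposability plays no role in this direction. -/
theorem mem_range_sharp {p : Trivector L} {v : L} {a b c : Module.Dual ℝ L}
    (h : p ![a, b, c] ≠ 0)
    (hv : ∀ w : Module.Dual ℝ L,
      p ![a, b, c] * w v = a v * p ![b, c, w] + b v * p ![c, a, w] + c v * p ![a, b, w]) :
    v ∈ LinearMap.range (sharp p) := by
  have hsmul : p ![a, b, c] • v = sharp p (a v • exteriorPower.ιMulti ℝ 2 ![b, c] +
      b v • exteriorPower.ιMulti ℝ 2 ![c, a] + c v • exteriorPower.ιMulti ℝ 2 ![a, b]) := by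
    rw [← sub_eq_zero, ← Module.forall_dual_apply_eq_zero_iff ℝ]
    intro w
    simp only [map_sub, map_add, map_smul, apply_sharp, smul_eq_mul, hv w, sub_self]
  have : v = (p ![a, b, c])⁻¹ • (p ![a, b, c] • v) := by rw [smul_smul, inv_mul_cancel₀ h, one_smul]
  rw [this]
  exact Submodule.smul_mem _ _ (hsmul ▸ LinearMap.mem_range_self _ _)

theorem eq_zero_of_mem_range_sharp {p : Trivector L} (hp : ∀ a b c, p ![a, b, c] = 0) {v : L}
    (hv : v ∈ LinearMap.range (sharp p)) : v = 0 := by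
  have : p = 0 := by
    ext y
    have hy : y = ![y 0, y 1, y 2] := by funext i; fin_cases i <;> rfl
    rw [hy, hp]; rfl
  obtain ⟨l, rfl⟩ := hv
  have hflip : (exteriorPower.alternatingMapLinearEquiv.toLinearMap ∘ₗ
      AlternatingMap.curryLeft p).flip = 0 := by
    refine LinearMap.ext₂ fun l w => ?_
    simp [this]
  rw [sharp, hflip, LinearMap.comp_zero, LinearMap.zero_apply]

end Trivectors

/-! ### Hamiltonian fields and the pointwise content of the generalized Jacobi identity. -/

section Fields

variable {m : ℕ} {M : Type*} [TopologicalSpace M] [ChartedSpace (EuclideanSpace ℝ (Fin m)) M]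
  [IsManifold (𝓡 m) ∞ M]

/-- A vector field is smooth if it maps smooth functions to smooth functions. -/
theorem contMDiff_of_differential_apply [T2Space M] {X : ∀ y : M, TangentSpace (𝓡 m) y}
    (h : ∀ f : C^∞⟮𝓡 m, M; ℝ⟯, ContMDiff (𝓡 m) 𝓘(ℝ, ℝ) ∞ fun y => differential m f y (X y)) :
    ContMDiff (𝓡 m) (𝓡 m).tangent ∞ (fun x => (⟨x, X x⟩ : TangentBundle (𝓡 m) M)) := by
  have : IsManifold (𝓡 m) 1 M := IsManifold.of_le (n := ∞) (by simp)
  intro x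
  refine (Bundle.contMDiffAt_section (F := EuclideanSpace ℝ (Fin m)) (E := TangentSpace (𝓡 m))
    (s := X) x).2 ?_
  have hsmooth : ContMDiffAt (𝓡 m) 𝓘(ℝ, Fin m → ℝ) ∞ (fun y i =>
      (trivializationAt (EuclideanSpace ℝ (Fin m)) (TangentSpace (𝓡 m)) x ⟨y, X y⟩).2 i) x := by
    refine contMDiffAt_pi_space.2 fun i => ?_
    -- The `i`-th component of `X` in the trivialization at `x` is `X` applied to the `i`-th
    -- coordinate, which agrees near `x` with a global smooth function.
    obtain ⟨c, hc⟩ := exists_smooth_eventuallyEq_coord x i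
    refine (h c).contMDiffAt.congr_of_eventuallyEq ?_
    filter_upwards [hc.eventuallyEq_nhds,
      (chartAt (EuclideanSpace ℝ (Fin m)) x).open_source.mem_nhds
        (mem_chart_source (EuclideanSpace ℝ (Fin m)) x)] with y hy hys
    rw [differential_congr hy]
    have e := mfderiv_eq_comp_chart (EuclideanSpace.proj (𝕜 := ℝ) i : EuclideanSpace ℝ (Fin m) → ℝ)
      x hys (EuclideanSpace.proj (𝕜 := ℝ) i).differentiableAt (X y)
    rw [ContinuousLinearMap.fderiv] at e
    refine Eq.trans ?_ e.symm
    have t := TangentBundle.continuousLinearMapAt_trivializationAt (I := 𝓡 m) hys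
    have t' := Bundle.Trivialization.continuousLinearMapAt_apply_of_mem (R := ℝ)
      (trivializationAt (EuclideanSpace ℝ (Fin m)) (TangentSpace (𝓡 m)) x)
      (b := y) hys (X y)
    rw [← t', t]
    rfl
  exact (EuclideanSpace.equiv (Fin m) ℝ).symm.contDiff.contMDiff.contMDiffAt.comp x hsmooth

namespace TrivectorField

variable (P : TrivectorField m M)

theorem bracket_vec (f g h : C^∞⟮𝓡 m, M; ℝ⟯) (x : M) :
    P.bracket ![f, g, h] x =
      P.toFun x ![differential m f x, differential m g x, differential m h x] := by
  rw [bracket_apply]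
  congr 1
  funext i
  fin_cases i <;> rfl

theorem bracket_leibniz (h : Fin 3 → C^∞⟮𝓡 m, M; ℝ⟯) (i : Fin 3) (f g : C^∞⟮𝓡 m, M; ℝ⟯) :
    P.bracket (Function.update h i (f * g)) =
      f * P.bracket (Function.update h i g) + g * P.bracket (Function.update h i f) := by
  ext x
  have e : ∀ a : C^∞⟮𝓡 m, M; ℝ⟯, (fun k => differential m (Function.update h i a k) x) =
      Function.update (fun k => differential m (h k) x) i (differential m a x) := fun a => by
    funext k
    by_cases hk : k = i
    · subst hk; simp
    · simp [hk]
  simp only [ContMDiffMap.coe_add, ContMDiffMap.coe_mul, Pi.add_apply, Pi.mul_apply,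
    bracket_apply, e]
  rw [differential_mul (mdifferentiableAt_smooth f x) (mdifferentiableAt_smooth g x),
    AlternatingMap.map_update_add, AlternatingMap.map_update_smul, AlternatingMap.map_update_smul]
  rfl

theorem bracket_mul_vec (f g h k : C^∞⟮𝓡 m, M; ℝ⟯) :
    P.bracket ![f * g, h, k] = f * P.bracket ![g, h, k] + g * P.bracket ![f, h, k] := by
  simpa only [update_vec_zero] using P.bracket_leibniz ![f, h, k] 0 f g

/-- The Hamiltonian vector field of a pair of functions. -/
def hamiltonian (f g : M → ℝ) (x : M) : TangentSpace (𝓡 m) x :=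
  sharp (P.toFun x) (exteriorPower.ιMulti ℝ 2 ![differential m f x, differential m g x])

omit [IsManifold (𝓡 m) ∞ M] in
theorem hamiltonian_mem_imSharp (f g : M → ℝ) (x : M) : P.hamiltonian f g x ∈ P.imSharp x :=
  LinearMap.mem_range_self _ _

theorem differential_hamiltonian (f g h : C^∞⟮𝓡 m, M; ℝ⟯) (x : M) :
    differential m h x (P.hamiltonian f g x) = P.bracket ![f, g, h] x := by
  rw [bracket_vec]
  exact apply_sharp _ _ _ _

theorem contMDiff_hamiltonian [T2Space M] (f g : C^∞⟮𝓡 m, M; ℝ⟯) :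
    ContMDiff (𝓡 m) (𝓡 m).tangent ∞
      (fun x => (⟨x, P.hamiltonian f g x⟩ : TangentBundle (𝓡 m) M)) := by
  refine contMDiff_of_differential_apply fun h => ?_
  simp only [differential_hamiltonian]
  exact (P.bracket ![f, g, h]).contMDiff

variable {P}

/-- The trivector of a ternary Poisson bracket has decomposable contractions at each point. -/
theorem IsPoisson.hasDecomposableContractions [T2Space M] (hP : P.IsPoisson) (x : M) :
    HasDecomposableContractions (P.toFun x) := by
  intro a b c d e
  obtain ⟨u, hu0, hu⟩ := exists_differential_eq x a
  obtain ⟨f₁, -, h₁⟩ := exists_differential_eq x b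
  obtain ⟨f₂, -, h₂⟩ := exists_differential_eq x c
  obtain ⟨f₃, -, h₃⟩ := exists_differential_eq x d
  obtain ⟨f₄, -, h₄⟩ := exists_differential_eq x e
  -- The first entry is `u²/2`, which has vanishing differential at `x` and Hessian `a ⊗ a` there.
  let f : Fin 5 → C^∞⟮𝓡 m, M; ℝ⟯ := ![u * ((1 / 2 : ℝ) • u), f₁, f₂, f₃, f₄]
  have hw : differential m ((1 / 2 : ℝ) • u : C^∞⟮𝓡 m, M; ℝ⟯) x = (1 / 2 : ℝ) • a := by
    rw [ContMDiffMap.coe_smul, differential_smul (mdifferentiableAt_smooth u x), hu]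
  have hw0 : ((1 / 2 : ℝ) • u : C^∞⟮𝓡 m, M; ℝ⟯) x = 0 := by
    rw [ContMDiffMap.coe_smul, Pi.smul_apply, hu0, smul_zero]
  have hf0 : differential m (f 0) x = 0 := by
    change differential m (u * ((1 / 2 : ℝ) • u) : C^∞⟮𝓡 m, M; ℝ⟯) x = 0
    rw [ContMDiffMap.coe_mul, differential_mul (mdifferentiableAt_smooth _ x)
      (mdifferentiableAt_smooth _ x), hu0, hw0, zero_smul, zero_smul, add_zero]
  -- By Leibniz the bracket is `u{u/2,g,h} + (u/2){u,g,h}`; since `u x = 0`, only derivatives of the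
  -- prefactors survive, and the two halves add up.
  have hB : ∀ g h : C^∞⟮𝓡 m, M; ℝ⟯, differential m (P.bracket ![f 0, g, h]) x =
      P.toFun x ![a, differential m g x, differential m h x] • a := by
    intro g h
    change differential m (P.bracket ![u * ((1 / 2 : ℝ) • u), g, h]) x = _
    rw [bracket_mul_vec, ContMDiffMap.coe_add, ContMDiffMap.coe_mul, ContMDiffMap.coe_mul,
      differential_add
        ((mdifferentiableAt_smooth _ x).mul (mdifferentiableAt_smooth _ x))
        ((mdifferentiableAt_smooth _ x).mul (mdifferentiableAt_smooth _ x)),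
      differential_mul (mdifferentiableAt_smooth _ x) (mdifferentiableAt_smooth _ x),
      differential_mul (mdifferentiableAt_smooth _ x) (mdifferentiableAt_smooth _ x),
      hu0, hw0, bracket_vec, bracket_vec, hw, hu, zero_smul, zero_smul,
      zero_add, zero_add, smul_smul, ← add_smul]
    congr 1
    rw [alternating_smul_zero (P.toFun x) (1 / 2 : ℝ) a, smul_eq_mul]
    ring
  have hsum := sum_perm_five_sign
    (fun i j k l n => P.bracket ![P.bracket ![f i, f j, f k], f l, f n] x)
    (fun i j => P.toFun x ![a, differential m (f i) x, differential m (f j) x])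
    (fun i j k l n => by
      rw [alternating_swap_zero_one _ (f i) (f j) (f k), alternating_neg_zero]
      rfl)
    (fun i j k l n => by
      rw [alternating_swap_zero_two _ (f i) (f j) (f k), alternating_neg_zero]
      rfl)
    (fun i j k n => by rw [bracket_vec, hf0, alternating_zero_one])
    (fun i j k l => by rw [bracket_vec, hf0, alternating_zero_two])
    (fun i j k l => by
      rw [bracket_vec, hB, alternating_smul_zero, smul_eq_mul])
    (fun i j => alternating_swap_one_two _ _ _ _)
  have hj := congrArg (ContMDiffMap.evalRingHom (I := 𝓡 m) (I' := 𝓘(ℝ, ℝ)) (n := ∞) x) (hP f)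
  rw [map_sum, map_zero] at hj
  have hj' : ∑ σ : Equiv.Perm (Fin 5), ((Equiv.Perm.sign σ : ℤ) : ℝ) *
      P.bracket ![P.bracket ![f (σ 0), f (σ 1), f (σ 2)], f (σ 3), f (σ 4)] x = 0 := by
    refine Eq.trans (Finset.sum_congr rfl fun σ _ => ?_) hj
    rw [map_zsmul, zsmul_eq_mul]
    rfl
  rw [hj'] at hsum
  have := (mul_eq_zero.1 hsum.symm).resolve_left (by norm_num)
  simpa [f, h₁, h₂, h₃, h₄] using this

end TrivectorField

end Fields

end NambuPoisson

end

noncomputable section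

namespace NambuPoisson

open scoped Topology
open VectorField

/-! ### The fundamental identity implies involutivity. -/

section Involutivity

variable {m : ℕ} {M : Type*} [TopologicalSpace M] [ChartedSpace (EuclideanSpace ℝ (Fin m)) M]
  [IsManifold (𝓡 m) ∞ M]

namespace TrivectorField

variable {P : TrivectorField m M}

/-- Expansion of a vector field tangent to `im ♯_P` in a local frame of Hamiltonian fields. -/
theorem apply_mem_imSharp {x : M} (hp : HasDecomposableContractions (P.toFun x))
    {v : TangentSpace (𝓡 m) x} (hv : v ∈ P.imSharp x) {a b c : C^∞⟮𝓡 m, M; ℝ⟯}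
    (h : P.bracket ![a, b, c] x ≠ 0) (f : C^∞⟮𝓡 m, M; ℝ⟯) :
    P.bracket ![a, b, c] x * differential m f x v =
      differential m a x v * P.bracket ![b, c, f] x +
        differential m b x v * P.bracket ![c, a, f] x +
        differential m c x v * P.bracket ![a, b, f] x := by
  simp only [bracket_vec] at h ⊢
  exact hp.apply_mem_range_sharp hv h _

theorem mem_imSharp [T2Space M] {x : M} {v : TangentSpace (𝓡 m) x} {a b c : C^∞⟮𝓡 m, M; ℝ⟯}
    (h : P.bracket ![a, b, c] x ≠ 0)
    (hv : ∀ f : C^∞⟮𝓡 m, M; ℝ⟯, P.bracket ![a, b, c] x * differential m f x v =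
      differential m a x v * P.bracket ![b, c, f] x +
        differential m b x v * P.bracket ![c, a, f] x +
        differential m c x v * P.bracket ![a, b, f] x) : v ∈ P.imSharp x := by
  simp only [bracket_vec] at h hv
  refine mem_range_sharp h fun w => ?_
  obtain ⟨f, -, rfl⟩ := exists_differential_eq x w
  exact hv f

theorem exists_bracket_ne_zero [T2Space M] {x : M} {α β γ : Module.Dual ℝ (TangentSpace (𝓡 m) x)}
    (h : P.toFun x ![α, β, γ] ≠ 0) :
    ∃ a b c : C^∞⟮𝓡 m, M; ℝ⟯, P.bracket ![a, b, c] x ≠ 0 := by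
  obtain ⟨a, -, rfl⟩ := exists_differential_eq x α
  obtain ⟨b, -, rfl⟩ := exists_differential_eq x β
  obtain ⟨c, -, rfl⟩ := exists_differential_eq x γ
  exact ⟨a, b, c, by rwa [bracket_vec]⟩

/-- The derivative of `apply_mem_imSharp` along a tangent vector `w`. -/
theorem differential_apply_mem_imSharp {x : M}
    (hp : ∀ y, HasDecomposableContractions (P.toFun y))
    {Y : ∀ y : M, TangentSpace (𝓡 m) y} (hYD : ∀ᶠ y in 𝓝 x, Y y ∈ P.imSharp y)
    (hY : MDifferentiableAt (𝓡 m) (𝓡 m).tangent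
      (fun y => (⟨y, Y y⟩ : TangentBundle (𝓡 m) M)) x)
    {a b c : C^∞⟮𝓡 m, M; ℝ⟯} (h : P.bracket ![a, b, c] x ≠ 0) (f : C^∞⟮𝓡 m, M; ℝ⟯)
    (w : TangentSpace (𝓡 m) x) :
    differential m (P.bracket ![a, b, c]) x w * differential m f x (Y x) +
      P.bracket ![a, b, c] x * differential m (fun y => differential m f y (Y y)) x w =
    (differential m a x (Y x) * differential m (P.bracket ![b, c, f]) x w +
      differential m (fun y => differential m a y (Y y)) x w * P.bracket ![b, c, f] x) +
    (differential m b x (Y x) * differential m (P.bracket ![c, a, f]) x w +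
      differential m (fun y => differential m b y (Y y)) x w * P.bracket ![c, a, f] x) +
    (differential m c x (Y x) * differential m (P.bracket ![a, b, f]) x w +
      differential m (fun y => differential m c y (Y y)) x w * P.bracket ![a, b, f] x) := by
  have hne : ∀ᶠ y in 𝓝 x, P.bracket ![a, b, c] y ≠ 0 :=
    (P.bracket ![a, b, c]).contMDiff.continuous.continuousAt.eventually_ne h
  have hev : ((P.bracket ![a, b, c] : M → ℝ) * fun y => differential m f y (Y y)) =ᶠ[𝓝 x]
      (fun y => differential m a y (Y y)) * (P.bracket ![b, c, f] : M → ℝ) +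
        (fun y => differential m b y (Y y)) * (P.bracket ![c, a, f] : M → ℝ) +
        (fun y => differential m c y (Y y)) * (P.bracket ![a, b, f] : M → ℝ) := by
    filter_upwards [hYD, hne] with y hy hny
    exact apply_mem_imSharp (hp y) hy hny f
  have hd := fun g => mdifferentiableAt_differential_apply (x := x) g hY
  have hs := fun g : C^∞⟮𝓡 m, M; ℝ⟯ => mdifferentiableAt_smooth g x
  have key := DFunLike.congr_fun (differential_congr hev) w
  rw [differential_mul (hs _) (hd _),
    differential_add (((hd _).mul (hs _)).add ((hd _).mul (hs _))) ((hd _).mul (hs _)),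
    differential_add ((hd _).mul (hs _)) ((hd _).mul (hs _)),
    differential_mul (hd _) (hs _), differential_mul (hd _) (hs _),
    differential_mul (hd _) (hs _)] at key
  simp only [LinearMap.add_apply, LinearMap.smul_apply, smul_eq_mul] at key
  linear_combination key

/-- The commutators of the Hamiltonian fields of the local frame. -/
theorem frame_commutator (hN : IsNambuPoisson P.bracket) {x : M}
    (hp : HasDecomposableContractions (P.toFun x)) {a b c : C^∞⟮𝓡 m, M; ℝ⟯}
    (h : P.bracket ![a, b, c] x ≠ 0) (f : C^∞⟮𝓡 m, M; ℝ⟯) :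
    P.bracket ![a, b, c] x * (P.bracket ![b, c, P.bracket ![c, a, f]] x -
      P.bracket ![c, a, P.bracket ![b, c, f]] x) =
    P.bracket ![b, c, P.bracket ![a, b, c]] x * P.bracket ![c, a, f] x -
      P.bracket ![c, a, P.bracket ![a, b, c]] x * P.bracket ![b, c, f] x := by
  -- With `{b,c,c} = 0`, the fundamental identity reduces the commutator to `{c, F, f}`, where `F =
  -- {a,b,c}`.
  have hFI := congrArg (fun u : C^∞⟮𝓡 m, M; ℝ⟯ => u x) (hN.fundamental b c c a f)
  have hcc : P.bracket ![b, c, c] = 0 :=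
    P.bracket.map_eq_zero_of_eq _ (i := 1) (j := 2) rfl (by decide)
  simp only [ContMDiffMap.coe_add, Pi.add_apply] at hFI
  rw [hcc, alternating_zero_zero, ← alternating_rotate P.bracket b c a] at hFI
  -- Expand `{c,f,F}` in the frame; the third coefficient `{c,f,c}` is zero.
  have hv := apply_mem_imSharp hp (P.hamiltonian_mem_imSharp c f x) h (P.bracket ![a, b, c])
  simp only [differential_hamiltonian] at hv
  have hc : P.bracket ![c, f, c] = 0 :=
    P.bracket.map_eq_zero_of_eq _ (i := 0) (j := 2) rfl (by decide)
  rw [hc, alternating_swap_one_two _ c a f, alternating_swap_one_two _ c _ f,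
    ← alternating_rotate P.bracket c f b] at hv
  simp only [ContMDiffMap.coe_neg, Pi.neg_apply, ContMDiffMap.coe_zero, Pi.zero_apply] at hv hFI
  linear_combination (P.bracket ![a, b, c] x) * hFI - hv

theorem isInvolutive_imSharp [T2Space M] (hN : IsNambuPoisson P.bracket)
    (hp : ∀ y, HasDecomposableContractions (P.toFun y)) : IsInvolutive P.imSharp := by
  intro U hU X Y hX hY hXD hYD x hx
  -- At a zero of `P` both fields vanish at `x`, which forces their bracket to vanish there.
  by_cases hz : ∀ α β γ, P.toFun x ![α, β, γ] = 0
  · rw [← mlieBracketWithin_univ, mlieBracketWithin_eq_zero_of_eq_zero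
      (eq_zero_of_mem_range_sharp hz (hXD x hx)) (eq_zero_of_mem_range_sharp hz (hYD x hx))]
    exact Submodule.zero_mem _
  push Not at hz
  obtain ⟨α, β, γ, hne⟩ := hz
  obtain ⟨a, b, c, h⟩ := exists_bracket_ne_zero hne
  have hUx := hU.mem_nhds hx
  have hXx := (hX.contMDiffAt hUx).mdifferentiableAt (by simp)
  have hYx := (hY.contMDiffAt hUx).mdifferentiableAt (by simp)
  refine mem_imSharp h fun f => ?_
  simp only [differential_mlieBracket _ hXx hYx]
  have hXe := fun g => apply_mem_imSharp (hp x) (hXD x hx) h g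
  have hYe := fun g => apply_mem_imSharp (hp x) (hYD x hx) h g
  have dY := differential_apply_mem_imSharp hp (Filter.mem_of_superset hUx hYD) hYx h f (X x)
  have dX := differential_apply_mem_imSharp hp (Filter.mem_of_superset hUx hXD) hXx h f (Y x)
  have cab := frame_commutator hN (hp x) h f
  have hb : P.bracket ![b, c, a] = P.bracket ![a, b, c] := (alternating_rotate _ _ _ _).symm
  have hc : P.bracket ![c, a, b] = P.bracket ![a, b, c] := alternating_rotate _ _ _ _
  -- The other two commutators follow by cyclic rotation of `(a,b,c)`, which preserves `F`.
  have cbc := frame_commutator hN (hp x) (a := b) (b := c) (c := a) (by rwa [hb]) f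
  have cca := frame_commutator hN (hp x) (a := c) (b := a) (c := b) (by rwa [hc]) f
  rw [hb] at cbc
  rw [hc] at cca
  have XF := hXe (P.bracket ![a, b, c])
  have YF := hYe (P.bracket ![a, b, c])
  have X1 := hXe (P.bracket ![b, c, f])
  have X2 := hXe (P.bracket ![c, a, f])
  have X3 := hXe (P.bracket ![a, b, f])
  have Y1 := hYe (P.bracket ![b, c, f])
  have Y2 := hYe (P.bracket ![c, a, f])
  have Y3 := hYe (P.bracket ![a, b, f])
  have Xf := hXe f
  have Yf := hYe f
  clear hXe hYe
  generalize P.bracket ![b, c, f] = k₁ at *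
  generalize P.bracket ![c, a, f] = k₂ at *
  generalize P.bracket ![a, b, f] = k₃ at *
  generalize P.bracket ![a, b, c] = F at *
  -- The factors of `F` clear denominators: one for expanding derivatives of the `kᵢ` and `F` along
  -- `X` and `Y`, one for the expansions of `Xf`, `Yf` and of the frame commutators.
  apply mul_left_cancel₀ (pow_ne_zero 2 h)
  generalize differential m a x (X x) = a₁ at *
  generalize differential m b x (X x) = a₂ at *
  generalize differential m c x (X x) = a₃ at *
  generalize differential m a x (Y x) = b₁ at *
  generalize differential m b x (Y x) = b₂ at *
  generalize differential m c x (Y x) = b₃ at *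
  linear_combination (F x) ^ 2 * (dY - dX) + F x * (b₁ * X1 + b₂ * X2 + b₃ * X3)
    - F x * (a₁ * Y1 + a₂ * Y2 + a₃ * Y3)
    - F x * differential m F x (X x) * Yf - (b₁ * k₁ x + b₂ * k₂ x + b₃ * k₃ x) * XF
    + F x * differential m F x (Y x) * Xf + (a₁ * k₁ x + a₂ * k₂ x + a₃ * k₃ x) * YF
    + (b₂ * a₁ - b₁ * a₂) * cab + (b₃ * a₂ - b₂ * a₃) * cbc + (b₁ * a₃ - b₃ * a₁) * cca

end TrivectorField

end Involutivity

end NambuPoisson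

end

noncomputable section

namespace NambuPoisson

open scoped Topology
open VectorField

/-! ### Involutivity implies the fundamental identity. -/

section Defect

/-- An alternating function that is a combination of its values on three vectors in the last slot
vanishes if it vanishes on these three vectors. -/
theorem eq_zero_of_expansion {V : Type*} (S k : V → V → V → ℝ)
    (h₀ : ∀ g g', S g g g' = 0) (h₁ : ∀ a b c, S b a c = -S a b c)
    (h₂ : ∀ a b c, S a c b = -S a b c) {a b c : V} (hk : k a b c ≠ 0)
    (hS : ∀ g g' g'', k a b c * S g g' g'' =
      S g g' a * k b c g'' + S g g' b * k c a g'' + S g g' c * k a b g'')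
    (habc : S a b c = 0) (g g' g'' : V) : S g g' g'' = 0 := by
  have h₃ : ∀ a b, S a b b = 0 := fun a b => by
    have := h₂ a b b
    linarith
  have h₄ : ∀ a b, S a b a = 0 := fun a b => by rw [h₂, h₀, neg_zero]
  -- Used three times, for pairs with two, one and then no entries among `a`, `b`, `c`.
  have expand : ∀ g g', S g g' a = 0 → S g g' b = 0 → S g g' c = 0 → ∀ g'', S g g' g'' = 0 := by
    intro g g' ha hb hc g''
    have := hS g g' g''
    rw [ha, hb, hc] at this
    exact (mul_eq_zero.1 (this.trans (by ring))).resolve_left hk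
  have rot : ∀ x y z, S z x y = S x y z := fun x y z => by rw [h₁, h₂, neg_neg]
  have hab : ∀ g, S a b g = 0 := expand a b (h₄ a b) (h₃ a b) habc
  have hbc : ∀ g, S b c g = 0 :=
    expand b c (by rw [← rot, habc]) (h₄ b c) (h₃ b c)
  have hca : ∀ g, S c a g = 0 :=
    expand c a (h₃ c a) (by rw [rot, habc]) (h₄ c a)
  have ha : ∀ g g', S a g g' = 0 := fun g => expand a g (h₄ a g) (by rw [h₂, hab, neg_zero])
    (by rw [h₂, h₁, hca, neg_zero, neg_zero])
  have hb : ∀ g g', S b g g' = 0 := fun g => expand b g (by rw [h₂, h₁, hab, neg_zero, neg_zero])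
    (h₄ b g) (by rw [h₂, hbc, neg_zero])
  have hc : ∀ g g', S c g g' = 0 := fun g => expand c g (by rw [h₂, hca, neg_zero])
    (by rw [h₂, h₁, hbc, neg_zero, neg_zero]) (h₄ c g)
  exact expand g g' (by rw [← rot, ha]) (by rw [← rot, hb]) (by rw [← rot, hc]) g''

variable {m : ℕ} {M : Type*} [TopologicalSpace M] [ChartedSpace (EuclideanSpace ℝ (Fin m)) M]
  [IsManifold (𝓡 m) ∞ M]

namespace TrivectorField

/-- The failure of the fundamental identity. -/
def defect (P : TrivectorField m M) (f₁ f₂ g₁ g₂ g₃ : C^∞⟮𝓡 m, M; ℝ⟯) : C^∞⟮𝓡 m, M; ℝ⟯ :=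
  P.bracket ![f₁, f₂, P.bracket ![g₁, g₂, g₃]] -
    (P.bracket ![P.bracket ![f₁, f₂, g₁], g₂, g₃] + P.bracket ![g₁, P.bracket ![f₁, f₂, g₂], g₃] +
      P.bracket ![g₁, g₂, P.bracket ![f₁, f₂, g₃]])

variable {P : TrivectorField m M}

theorem defect_swap_zero_one (f₁ f₂ g₁ g₂ g₃ : C^∞⟮𝓡 m, M; ℝ⟯) :
    P.defect f₁ f₂ g₂ g₁ g₃ = -P.defect f₁ f₂ g₁ g₂ g₃ := by
  simp only [defect]
  rw [alternating_swap_zero_one _ g₁ g₂, alternating_neg_two, alternating_swap_zero_one _ g₁,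
    alternating_swap_zero_one _ (P.bracket ![f₁, f₂, g₁]), alternating_swap_zero_one _ g₁ g₂]
  abel

theorem defect_swap_one_two (f₁ f₂ g₁ g₂ g₃ : C^∞⟮𝓡 m, M; ℝ⟯) :
    P.defect f₁ f₂ g₁ g₃ g₂ = -P.defect f₁ f₂ g₁ g₂ g₃ := by
  simp only [defect]
  rw [alternating_swap_one_two _ g₁ g₂ g₃, alternating_neg_two, alternating_swap_one_two _ _ g₂,
    alternating_swap_one_two _ g₁ g₂, alternating_swap_one_two _ g₁ _ g₃]
  abel

theorem defect_add_right (f₁ f₂ f₂' g₁ g₂ g₃ : C^∞⟮𝓡 m, M; ℝ⟯) :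
    P.defect f₁ (f₂ + f₂') g₁ g₂ g₃ = P.defect f₁ f₂ g₁ g₂ g₃ + P.defect f₁ f₂' g₁ g₂ g₃ := by
  simp only [defect, alternating_add_one, alternating_add_zero, alternating_add_two]
  abel

theorem defect_add_left (f₁ f₁' f₂ g₁ g₂ g₃ : C^∞⟮𝓡 m, M; ℝ⟯) :
    P.defect (f₁ + f₁') f₂ g₁ g₂ g₃ = P.defect f₁ f₂ g₁ g₂ g₃ + P.defect f₁' f₂ g₁ g₂ g₃ := by
  simp only [defect, alternating_add_one, alternating_add_zero, alternating_add_two]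
  abel

/-- The brackets `{f₁,f₂,f₁}` and `{f₁,f₂,f₂}` vanish, and the two remaining terms coincide. -/
theorem defect_self (f₁ f₂ g : C^∞⟮𝓡 m, M; ℝ⟯) : P.defect f₁ f₂ f₁ f₂ g = 0 := by
  have h₁ : P.bracket ![f₁, f₂, f₁] = 0 :=
    P.bracket.map_eq_zero_of_eq _ (i := 0) (j := 2) rfl (by decide)
  have h₂ : P.bracket ![f₁, f₂, f₂] = 0 :=
    P.bracket.map_eq_zero_of_eq _ (i := 1) (j := 2) rfl (by decide)
  rw [defect, h₁, h₂, alternating_zero_zero, alternating_zero_one]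
  simp

variable [T2Space M]

/-- If `im ♯_P` is involutive, the defect of the fundamental identity is the derivative of its last
argument along a vector of `im ♯_P`. -/
theorem exists_defect_eq (hI : IsInvolutive P.imSharp) (f₁ f₂ g₁ g₂ : C^∞⟮𝓡 m, M; ℝ⟯) (x : M) :
    ∃ v ∈ P.imSharp x, ∀ g : C^∞⟮𝓡 m, M; ℝ⟯, P.defect f₁ f₂ g₁ g₂ g x = differential m g x v := by
  have hX := P.contMDiff_hamiltonian f₁ f₂
  have hY := P.contMDiff_hamiltonian g₁ g₂
  refine ⟨mlieBracket (𝓡 m) (P.hamiltonian f₁ f₂) (P.hamiltonian g₁ g₂) x -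
    (P.hamiltonian (P.bracket ![f₁, f₂, g₁]) g₂ x + P.hamiltonian g₁ (P.bracket ![f₁, f₂, g₂]) x),
    ?_, fun g => ?_⟩
  · exact Submodule.sub_mem _
      (hI Set.univ isOpen_univ _ _ hX.contMDiffOn hY.contMDiffOn
        (fun y _ => P.hamiltonian_mem_imSharp _ _ y) (fun y _ => P.hamiltonian_mem_imSharp _ _ y)
        x trivial)
      (Submodule.add_mem _ (P.hamiltonian_mem_imSharp _ _ x) (P.hamiltonian_mem_imSharp _ _ x))
  · rw [map_sub, map_add, differential_mlieBracket g (hX.contMDiffAt.mdifferentiableAt (by simp))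
      (hY.contMDiffAt.mdifferentiableAt (by simp)), funext (P.differential_hamiltonian f₁ f₂ g),
      funext (P.differential_hamiltonian g₁ g₂ g)]
    simp only [differential_hamiltonian, defect, ContMDiffMap.coe_sub, ContMDiffMap.coe_add,
      Pi.sub_apply, Pi.add_apply]
    ring

/-- The functions `f₁`, `f₂`, `f₃` themselves define the frame, so the alternating defect is
controlled by its value on `(f₁,f₂,f₃)`, an instance of `defect_self`. -/
theorem defect_eq_zero_of_bracket_ne_zero (hI : IsInvolutive P.imSharp) {x : M}
    (hp : HasDecomposableContractions (P.toFun x)) {f₁ f₂ f₃ : C^∞⟮𝓡 m, M; ℝ⟯}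
    (h : P.bracket ![f₁, f₂, f₃] x ≠ 0) (g₁ g₂ g₃ : C^∞⟮𝓡 m, M; ℝ⟯) :
    P.defect f₁ f₂ g₁ g₂ g₃ x = 0 := by
  have h₁ : ∀ a b c, P.defect f₁ f₂ b a c x = -P.defect f₁ f₂ a b c x := fun a b c => by
    rw [defect_swap_zero_one]; rfl
  have h₂ : ∀ a b c, P.defect f₁ f₂ a c b x = -P.defect f₁ f₂ a b c x := fun a b c => by
    rw [defect_swap_one_two]; rfl
  refine eq_zero_of_expansion (fun a b c => P.defect f₁ f₂ a b c x)
    (fun a b c => P.bracket ![a, b, c] x) (fun a b => ?_) h₁ h₂ h (fun g g' g'' => ?_) ?_ g₁ g₂ g₃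
  · have := h₁ a a b
    linarith
  · obtain ⟨v, hv, hS⟩ := exists_defect_eq hI f₁ f₂ g g' x
    simp only [hS]
    exact apply_mem_imSharp hp hv h g''
  · rw [defect_self]; rfl

theorem defect_eq_zero (hI : IsInvolutive P.imSharp)
    (hp : ∀ x, HasDecomposableContractions (P.toFun x)) (f₁ f₂ g₁ g₂ g₃ : C^∞⟮𝓡 m, M; ℝ⟯) :
    P.defect f₁ f₂ g₁ g₂ g₃ = 0 := by
  ext x
  change P.defect f₁ f₂ g₁ g₂ g₃ x = 0
  by_cases hz : ∀ α β γ, P.toFun x ![α, β, γ] = 0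
  · simp only [defect, ContMDiffMap.coe_sub, ContMDiffMap.coe_add, Pi.sub_apply, Pi.add_apply,
      bracket_vec, hz]
    ring
  push Not at hz
  obtain ⟨α, β, γ, hne⟩ := hz
  obtain ⟨a, b, c, habc⟩ := exists_bracket_ne_zero hne
  -- If `{f,f',l}` vanishes at `x`, then `{f,f'+k,l}` does not; the defects for `f'+k` and `k` both
  -- vanish, hence so does their difference. The first argument is perturbed by `a` in the same way
  -- below.
  have right : ∀ f k l : C^∞⟮𝓡 m, M; ℝ⟯, P.bracket ![f, k, l] x ≠ 0 → ∀ f',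
      P.defect f f' g₁ g₂ g₃ x = 0 := by
    intro f k l hl f'
    by_cases hf : P.bracket ![f, f', l] x = 0
    · have hk := defect_eq_zero_of_bracket_ne_zero hI (hp x) hl g₁ g₂ g₃
      have hadd : P.bracket ![f, f' + k, l] x ≠ 0 := by
        rw [alternating_add_one, ContMDiffMap.coe_add, Pi.add_apply, hf, zero_add]
        exact hl
      have := defect_eq_zero_of_bracket_ne_zero hI (hp x) hadd g₁ g₂ g₃
      rw [defect_add_right, ContMDiffMap.coe_add, Pi.add_apply, hk, add_zero] at this
      exact this
    · exact defect_eq_zero_of_bracket_ne_zero hI (hp x) hf g₁ g₂ g₃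
  by_cases hf : P.bracket ![f₁, b, c] x = 0
  · have ha := right a b c habc f₂
    have hadd : P.bracket ![f₁ + a, b, c] x ≠ 0 := by
      rw [alternating_add_zero, ContMDiffMap.coe_add, Pi.add_apply, hf, zero_add]
      exact habc
    have := right _ b c hadd f₂
    rw [defect_add_left, ContMDiffMap.coe_add, Pi.add_apply, ha, add_zero] at this
    exact this
  · exact right _ b c hf f₂

end TrivectorField

end Defect

end NambuPoisson

end

theorem corollary6 (m : ℕ) (M : Type*) [TopologicalSpace M] [T2Space M]
    [ChartedSpace (EuclideanSpace ℝ (Fin m)) M] [IsManifold (𝓡 m) ∞ M]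
    (P : NambuPoisson.TrivectorField m M) (hP : P.IsPoisson) :
    NambuPoisson.IsNambuPoisson P.bracket ↔ NambuPoisson.IsInvolutive P.imSharp :=
  ⟨fun hN => NambuPoisson.TrivectorField.isInvolutive_imSharp hN hP.hasDecomposableContractions,
    fun hI => ⟨P.bracket_leibniz, fun f₁ f₂ g₁ g₂ g₃ =>
      sub_eq_zero.1 (NambuPoisson.TrivectorField.defect_eq_zero hI
        hP.hasDecomposableContractions f₁ f₂ g₁ g₂ g₃)⟩⟩
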